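/- For an entire function $f$ and $r>0$ let $M(r,f)=\max_{|z|=r}|f(z)|$, and let $f^n$ denote the $n$-th iterate of $f$. The order and lower order of $f$ are $$\rho(f)=\limsup_{r\to\infty}\frac{\log\log M(r,f)}{\log r},\qquad \lambda(f)=\liminf_{r\to\infty}\frac{\log\log M(r,f)}{\log r}.$$ For a transcendental entire function $f$, the fast escaping set is $$A(f)=\{z\in\mathbb C:\ \exists\,\ell\in\mathbb N\ \text{such that}\ |f^{n+\ell}(z)|\ge M^n(R,f)\ \text{for all } n\in\mathbb N\},$$ where $M^n(\cdot,f)$ is the $n$-th iterate of $r\mapsto M(r,f)$ and $R>0$ is such that $M(r,f)>r$ for all $r\ge R$. For $\varepsilon\in(0,1)$ put $\mu_{2,\varepsilon}(r)=\exp\bigl((\log M(r,f))^{\varepsilon}\bigr)$, defined where $M(r,f)\ge 1$, and let $$Q_2(f)=\{z\in\mathbb C:\ \exists\,\varepsilon\in(0,1),\ \ell\in\mathbb N\ \text{such that}\ |f^{n+\ell}(z)|\ge \mu_{2,\varepsilon}^n(R)\ \text{for all } n\in\mathbb N\},$$ where $\mu_{2,\varepsilon}^n$ is the $n$-th iterate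 of $\mu_{2,\varepsilon}$ and $R>0$ (depending on $\varepsilon$) is such that $\mu_{2,\varepsilon}(r)$ is defined and $\mu_{2,\varepsilon}(r)>r$ for all $r\ge R$. (Neither set depends on the admissible choice of $R$.) **Theorem.** Let $f=f_1\circ f_2\circ\cdots\circ f_j$ $(j\ge 1)$ be a finite composition of transcendental entire functions, where $f_1$ has finite order and positive lower order, that is, $\rho(f_1)<\infty$ and $\lambda(f_1)>0$. Then $Q_2(f)=A(f)$. -/

import Mathlib

open Filter Topology

noncomputable section

namespace FastEscape

/-- A transcendental entire function: holomorphic on all of `ℂ` and not a polynomial function. -/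
def IsTranscendentalEntire (f : ℂ → ℂ) : Prop :=
  Differentiable ℂ f ∧ ¬ ∃ p : Polynomial ℂ, ∀ z, f z = p.eval z

/-- The maximum modulus `M(r, f) = max_{|z| = r} |f z|`. For `r ≥ 0` and continuous `f` the
supremum is over a nonempty compact set, hence is a maximum. -/
def maxModulus (f : ℂ → ℂ) (r : ℝ) : ℝ :=
  sSup ((fun z : ℂ => ‖f z‖) '' Metric.sphere (0 : ℂ) r)

/-- The order of `f`, the upper limit of `log log M(r, f) / log r`, as an extended real. -/
def order (f : ℂ → ℂ) : EReal :=
  limsup (fun r : ℝ =>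
    ((Real.log (Real.log (maxModulus f r)) / Real.log r : ℝ) : EReal)) atTop

/-- The lower order of `f`, the lower limit of `log log M(r, f) / log r`, as an extended real. -/
def lowerOrder (f : ℂ → ℂ) : EReal :=
  liminf (fun r : ℝ =>
    ((Real.log (Real.log (maxModulus f r)) / Real.log r : ℝ) : EReal)) atTop

/-- The fast escaping set `A(f)`: the points `z` such that, for some `ℓ`, `|f^{n+ℓ}(z)| ≥ M^n(R, f)`
for all `n`, where `R > 0` is such that `M(r, f) > r` for all `r ≥ R`. For transcendental entire `f`
such an `R` exists and the set does not depend on which one is used. -/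
def fastEscapingSet (f : ℂ → ℂ) : Set ℂ :=
  {z | ∃ R : ℝ, 0 < R ∧ (∀ r : ℝ, R ≤ r → r < maxModulus f r) ∧
    ∃ l : ℕ, ∀ n : ℕ, (maxModulus f)^[n] R ≤ ‖f^[n + l] z‖}

/-- The function `μ_{2,ε}(r) = exp ((log M(r, f)) ^ ε)`; meaningful where `M(r, f) ≥ 1`. -/
def mu2 (f : ℂ → ℂ) (ε : ℝ) (r : ℝ) : ℝ :=
  Real.exp ((Real.log (maxModulus f r)) ^ ε)

/-- The set `Q_2(f)`: the points `z` such that, for some `ε ∈ (0, 1)` and some `ℓ`,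
`|f^{n+ℓ}(z)| ≥ μ_{2,ε}^n(R)` for all `n`, where `R > 0` is such that, for all `r ≥ R`,
`μ_{2,ε}(r)` is defined (that is, `M(r, f) ≥ 1`) and `μ_{2,ε}(r) > r`. The points obtained for a
given `ε` do not depend on which such `R` is used. -/
def quiteFastEscapingSet2 (f : ℂ → ℂ) : Set ℂ :=
  {z | ∃ ε : ℝ, 0 < ε ∧ ε < 1 ∧
    ∃ R : ℝ, 0 < R ∧ (∀ r : ℝ, R ≤ r → 1 ≤ maxModulus f r ∧ r < mu2 f ε r) ∧
      ∃ l : ℕ, ∀ n : ℕ, (mu2 f ε)^[n] R ≤ ‖f^[n + l] z‖}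

/-- The composition `f₁ ∘ f₂ ∘ ⋯ ∘ f_j` of a list `[f₁, f₂, …, f_j]` of maps. -/
def composition (fs : List (ℂ → ℂ)) : ℂ → ℂ :=
  fs.foldr (fun g h => g ∘ h) id

end FastEscape

end

open Filter Topology

namespace FastEscape

open Metric

/-! Write F = f₁ ∘ g, with g the composition of the remaining maps (the identity if there are none).
The inclusion A(F) ⊆ Q₂(F) is soft: μ_{2,ε} ≤ M as soon as M ≥ e, and positive lower order of f₁
makes ε = 1/2 admissible. For the converse it suffices that, for each ε, some k satisfies M(r,F)^k ≤
μ_{2,ε}(r^k) for large r (`exists_maxModulus_pow_le_mu2`): the map r ↦ r^k then carries orbits of M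
below orbits of μ_{2,ε}.

Finite order of f₁ gives log M(r,F) ≤ M(r,g)^b. Positive lower order and a Pólya-type bound give log
M(r,F) ≥ (M(r/2,g)/C)^a. By the three circles theorem M(r^k,g) exceeds any prescribed power of
M(r,g) once k is large, which makes up for the exponents a, b and ε.

The Pólya-type bound rests on Bloch's theorem. If |f ∘ g| ≤ B < |f(w₀)| on a disc, then g omits w₀
and a point of every circle about w₀, so log(g - w₀) covers no disc of radius 4; hence it oscillates
boundedly, and g is controlled by w₀ and g(0). -/

/-! ### Bloch's theorem and bounds for inner functions -/

/-- **Bloch's theorem**, with the constant `1 / 48`. -/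
theorem exists_ball_subset_image {f : ℂ → ℂ} {c : ℂ} {r R : ℝ} (hr : 0 < r) (hrR : r < R)
    (hf : DifferentiableOn ℂ f (ball c R)) :
    ∃ w, ball w (r * ‖deriv f c‖ / 48) ⊆ f '' ball c R := by
  rcases eq_or_ne (deriv f c) 0 with h0 | h0
  · exact ⟨0, by simp [h0]⟩
  have hd' : DifferentiableOn ℂ (deriv f) (ball c R) := hf.deriv isOpen_ball
  have hsub : closedBall c r ⊆ ball c R := closedBall_subset_ball hrR
  have hcont : ContinuousOn (fun z => ‖deriv f z‖ * (r - ‖z - c‖)) (closedBall c r) :=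
    (hd'.continuousOn.mono hsub).norm.mul (by fun_prop)
  -- Landau's device: recentring at this maximum bounds `deriv f` by twice its value at `a` on the
  -- disc of radius half the gap `r - ‖a - c‖`.
  obtain ⟨a, ha, hmax⟩ := (isCompact_closedBall c r).exists_isMaxOn
    ⟨c, mem_closedBall_self hr.le⟩ hcont
  have hac : ‖deriv f c‖ * r ≤ ‖deriv f a‖ * (r - ‖a - c‖) := by
    simpa using hmax (mem_closedBall_self hr.le)
  have hpos : 0 < ‖deriv f a‖ * (r - ‖a - c‖) :=
    lt_of_lt_of_le (mul_pos (norm_pos_iff.2 h0) hr) hac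
  have hD : 0 < ‖deriv f a‖ := by
    rcases (norm_nonneg (deriv f a)).eq_or_lt with h | h
    · rw [← h] at hpos; simp at hpos
    · exact h
  have hgap : 0 < r - ‖a - c‖ := pos_of_mul_pos_right hpos hD.le
  set D := ‖deriv f a‖ with hDdef
  obtain ⟨t, ht⟩ : ∃ t, t = (r - ‖a - c‖) / 2 := ⟨_, rfl⟩
  have htpos : 0 < t := by rw [ht]; linarith
  have hball : ∀ z ∈ ball a t, ‖z - c‖ ≤ ‖a - c‖ + t := by
    intro z hz
    have h1 : ‖z - c‖ ≤ ‖z - a‖ + ‖a - c‖ := by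
      simpa using norm_add_le (z - a) (a - c)
    have h2 : ‖z - a‖ < t := by simpa [dist_eq_norm] using hz
    linarith
  have hballR : ball a t ⊆ ball c R := by
    intro z hz
    have := hball z hz
    rw [mem_ball, dist_eq_norm]
    linarith
  have hbound : ∀ z ∈ ball a t, ‖deriv f z‖ ≤ 2 * D := by
    intro z hz
    have h1 := hball z hz
    have h2 : ‖deriv f z‖ * (r - ‖z - c‖) ≤ D * (r - ‖a - c‖) :=
      hmax (show z ∈ closedBall c r by rw [mem_closedBall, dist_eq_norm]; linarith)
    have h3 : t ≤ r - ‖z - c‖ := by linarith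
    have h4 : ‖deriv f z‖ * t ≤ (2 * D) * t := by
      calc ‖deriv f z‖ * t ≤ ‖deriv f z‖ * (r - ‖z - c‖) := by gcongr
        _ ≤ D * (r - ‖a - c‖) := h2
        _ = (2 * D) * t := by rw [ht]; ring
    exact le_of_mul_le_mul_right h4 htpos
  have hschwarz : ∀ z ∈ ball a t, ‖deriv f z - deriv f a‖ ≤ 3 * D / t * ‖z - a‖ := by
    intro z hz
    rw [← dist_eq_norm, ← dist_eq_norm]
    refine Complex.dist_le_div_mul_dist_of_mapsTo_ball (hd'.mono hballR) ?_ hz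
    intro w hw
    rw [mem_closedBall, dist_eq_norm]
    have := norm_sub_le (deriv f w) (deriv f a)
    have := hbound w hw
    linarith
  have hsmall : closedBall a (t / 6) ⊆ ball a t := closedBall_subset_ball (by linarith)
  have hlin : ∀ z ∈ closedBall a (t / 6), ‖f z - f a - deriv f a * (z - a)‖ ≤ D / 2 * ‖z - a‖ := by
    intro z hz
    have key := (convex_closedBall a (t / 6)).norm_image_sub_le_of_norm_hasDerivWithin_le
      (f := fun z => f z - deriv f a * z) (f' := fun z => deriv f z - deriv f a) (C := D / 2)
      (fun x hx => ?_) (fun x hx => ?_) (mem_closedBall_self (by linarith)) hz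
    · rw [show f z - f a - deriv f a * (z - a) = f z - deriv f a * z - (f a - deriv f a * a) by ring]
      exact key
    · have hx' := hballR (hsmall hx)
      have h1 : HasDerivAt f (deriv f x) x :=
        (hf.differentiableAt (isOpen_ball.mem_nhds hx')).hasDerivAt
      have h2 : HasDerivAt (fun z => deriv f a * z) (deriv f a) x := by
        simpa using (hasDerivAt_id x).const_mul (deriv f a)
      exact (h1.sub h2).hasDerivWithinAt
    · refine (hschwarz x (hsmall hx)).trans ?_
      have hx1 : ‖x - a‖ ≤ t / 6 := by simpa [dist_eq_norm] using hx
      calc 3 * D / t * ‖x - a‖ ≤ 3 * D / t * (t / 6) := by gcongr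
        _ = D / 2 := by field_simp; norm_num
  have hlow : ∀ z ∈ closedBall a (t / 6), D / 2 * ‖z - a‖ ≤ ‖f z - f a‖ := by
    intro z hz
    have h1 := hlin z hz
    have h2 : ‖deriv f a * (z - a)‖ ≤ ‖f z - f a‖ + ‖f z - f a - deriv f a * (z - a)‖ := by
      simpa using norm_sub_le (f z - f a) (f z - f a - deriv f a * (z - a))
    rw [norm_mul] at h2
    linarith
  have hdc : DiffContOnCl ℂ f (ball a (t / 6)) :=
    DifferentiableOn.diffContOnCl ((hf.mono hballR).mono
      (closure_ball_subset_closedBall.trans hsmall))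
  -- On the circle of radius t/6 the distance to `f a` is at least D t/12; half of it is the radius
  -- covered, D t/24 = D (r - ‖a - c‖)/48.
  have himg := hdc.ball_subset_image_closedBall (ε := D * t / 12) (by linarith)
    (fun z hz => ?_) ?_
  · refine ⟨f a, (ball_subset_ball ?_).trans (himg.trans
      (Set.image_mono (hsmall.trans hballR)))⟩
    rw [ht]; linarith
  · have h1 := hlow z (sphere_subset_closedBall hz)
    have h2 : ‖z - a‖ = t / 6 := by simpa [dist_eq_norm] using hz
    rw [h2] at h1
    linarith
  · refine Frequently.filter_mono (Eventually.frequently (f := 𝓝[≠] a) ?_) nhdsWithin_le_nhds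
    filter_upwards [self_mem_nhdsWithin,
      mem_nhdsWithin_of_mem_nhds (closedBall_mem_nhds a (by linarith : 0 < t / 6))] with z hz hz'
    intro heq
    have h1 := hlow z hz'
    rw [heq, sub_self, norm_zero] at h1
    have : 0 < ‖z - a‖ := norm_pos_iff.2 (sub_ne_zero.2 hz)
    have : 0 < D / 2 * ‖z - a‖ := by positivity
    linarith

/-- A holomorphic function on a disc whose image contains no disc of radius `4` oscillates by a
bounded amount on the concentric disc of half the radius. -/
theorem norm_sub_le_of_forall_not_ball_subset_image {k : ℂ → ℂ} {R : ℝ} (hR : 0 < R)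
    (hk : DifferentiableOn ℂ k (ball 0 R)) (himg : ∀ w, ¬ ball w 4 ⊆ k '' ball 0 R)
    {z : ℂ} (hz : ‖z‖ ≤ R / 2) : ‖k z - k 0‖ ≤ 288 := by
  have hhalf : closedBall (0 : ℂ) (R / 2) ⊆ ball 0 R := closedBall_subset_ball (by linarith)
  have hbound : ∀ x ∈ closedBall (0 : ℂ) (R / 2), ‖deriv k x‖ ≤ 576 / R := by
    intro x hx
    have hsub : ball x (R / 2) ⊆ ball 0 R := by
      intro y hy
      have hx1 : ‖x‖ ≤ R / 2 := by simpa using hx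
      have hy1 : ‖y - x‖ < R / 2 := by simpa [dist_eq_norm] using hy
      have := norm_add_le (y - x) x
      rw [sub_add_cancel] at this
      rw [mem_ball_zero_iff]
      linarith
    -- A derivative above 576/R would give a disc of radius (R/3)(576/R)/48 = 4.
    obtain ⟨w, hw⟩ := exists_ball_subset_image (c := x) (r := R / 3) (R := R / 2)
      (by linarith) (by linarith) (hk.mono hsub)
    by_contra! hlt
    refine himg w ((ball_subset_ball ?_).trans (hw.trans (Set.image_mono hsub)))
    rw [div_lt_iff₀ hR] at hlt
    linarith
  have := (convex_closedBall (0 : ℂ) (R / 2)).norm_image_sub_le_of_norm_deriv_le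
    (fun x hx => hk.differentiableAt (isOpen_ball.mem_nhds (hhalf hx))) hbound
    (mem_closedBall_self (by linarith)) (show z ∈ closedBall (0 : ℂ) (R / 2) by simpa using hz)
  refine this.trans ?_
  rw [sub_zero]
  calc 576 / R * ‖z‖ ≤ 576 / R * (R / 2) := by gcongr
    _ = 288 := by field_simp; norm_num

/-- A nonvanishing holomorphic function on a disc has a holomorphic logarithm. -/
theorem exists_exp_eq_on_ball {h : ℂ → ℂ} {c : ℂ} {R : ℝ} (hR : 0 < R)
    (hh : DifferentiableOn ℂ h (ball c R)) (h0 : ∀ z ∈ ball c R, h z ≠ 0) :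
    ∃ k : ℂ → ℂ, DifferentiableOn ℂ k (ball c R) ∧ ∀ z ∈ ball c R, Complex.exp (k z) = h z := by
  have hq : DifferentiableOn ℂ (fun z => deriv h z / h z) (ball c R) :=
    (hh.deriv isOpen_ball).div hh h0
  obtain ⟨k, hkc, hk⟩ := hq.isExactOn_ball.with_val_at c (Complex.log (h c))
  refine ⟨k, fun z hz => (hk z hz).differentiableAt.differentiableWithinAt, fun z hz => ?_⟩
  have hc : c ∈ ball c R := mem_ball_self hR
  have hder : ∀ x ∈ ball c R, HasDerivAt (fun x => h x * Complex.exp (-k x)) 0 x := by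
    intro x hx
    have h1 := (hh.differentiableAt (isOpen_ball.mem_nhds hx)).hasDerivAt
    have h2 := (hk x hx).neg.cexp
    refine (h1.mul h2).congr_deriv ?_
    have := h0 x hx
    field_simp
    ring
  have hconst := (convex_ball c R).norm_image_sub_le_of_norm_hasDerivWithin_le (C := 0)
    (fun x hx => (hder x hx).hasDerivWithinAt) (by simp) hc hz
  rw [zero_mul] at hconst
  have heq := sub_eq_zero.1 (norm_le_zero_iff.1 hconst)
  rw [hkc, Complex.exp_neg, Complex.exp_neg, Complex.exp_log (h0 c hc),
    mul_inv_cancel₀ (h0 c hc)] at heq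
  exact (eq_of_mul_inv_eq_one heq).symm

/-- If `|f ∘ g| ≤ B` on a disc and `|f w₀| > B`, then `g` is bounded on the disc of half the radius
in terms of `|w₀|` and `|g 0|`. -/
theorem norm_le_of_norm_comp_le {f g : ℂ → ℂ} {R B : ℝ} {w₀ : ℂ} (hR : 0 < R)
    (hf : Differentiable ℂ f) (hg : DifferentiableOn ℂ g (ball 0 R))
    (hB : ∀ z ∈ ball (0 : ℂ) R, ‖f (g z)‖ ≤ B) (hw : B < ‖f w₀‖) {z : ℂ} (hz : ‖z‖ ≤ R / 2) :
    ‖g z‖ ≤ ‖w₀‖ + Real.exp 288 * (‖g 0‖ + ‖w₀‖) := by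
  have homit : ∀ w, B < ‖f w‖ → ∀ x ∈ ball (0 : ℂ) R, g x ≠ w := by
    rintro w hw x hx rfl
    exact absurd (hB x hx) (not_le.2 hw)
  obtain ⟨k, hk, hke⟩ := exists_exp_eq_on_ball hR (hg.sub (differentiableOn_const w₀))
    (fun x hx => sub_ne_zero.2 (homit w₀ hw x hx))
  have hzR : z ∈ ball (0 : ℂ) R := by rw [mem_ball_zero_iff]; linarith
  have h0R : (0 : ℂ) ∈ ball (0 : ℂ) R := mem_ball_self hR
  have hosc : ‖k z - k 0‖ ≤ 288 := by
    refine norm_sub_le_of_forall_not_ball_subset_image hR hk (fun κ hκ => ?_) hz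
    have ht : 0 < Real.exp κ.re := Real.exp_pos _
    -- By the maximum principle the circle of radius exp(Re κ) about w₀ carries a value omitted by
    -- `g`. Some logarithm of `w - w₀` lies on the vertical line through κ, within π < 4 of it.
    obtain ⟨w, hwf, hwmax⟩ := Complex.exists_mem_frontier_isMaxOn_norm
      (isBounded_ball (x := w₀) (r := Real.exp κ.re)) ⟨w₀, mem_ball_self ht⟩ hf.diffContOnCl
    rw [frontier_ball _ ht.ne'] at hwf
    have hwB : B < ‖f w‖ := hw.trans_le (hwmax (subset_closure (mem_ball_self ht)))
    have hwt : ‖w - w₀‖ = Real.exp κ.re := by simpa [dist_eq_norm] using hwf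
    have hww : w - w₀ ≠ 0 := norm_pos_iff.1 (hwt ▸ ht)
    set u := (w - w₀) / Complex.exp κ with hu
    have hu1 : ‖u‖ = 1 := by rw [hu, norm_div, Complex.norm_exp, hwt, div_self ht.ne']
    have hu0 : u ≠ 0 := norm_pos_iff.1 (by rw [hu1]; exact one_pos)
    have hmem : κ + Complex.log u ∈ ball κ 4 := by
      have hre : (Complex.log u).re = 0 := by rw [Complex.log_re, hu1, Real.log_one]
      have hnorm := Complex.norm_le_abs_re_add_abs_im (Complex.log u)
      rw [hre, abs_zero, zero_add, Complex.log_im] at hnorm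
      have := Complex.abs_arg_le_pi u
      have := Real.pi_lt_four
      rw [mem_ball, dist_eq_norm, add_sub_cancel_left]
      linarith
    obtain ⟨x, hx, hkx⟩ := hκ hmem
    refine homit w hwB x hx ?_
    have h1 := hke x hx
    rw [hkx, Complex.exp_add, Complex.exp_log hu0, hu, mul_div_cancel₀ _ (Complex.exp_ne_zero _)]
      at h1
    simpa using h1.symm
  have hexp : ‖g z - w₀‖ ≤ Real.exp 288 * ‖g 0 - w₀‖ := by
    have h1 : g z - w₀ = Complex.exp (k z - k 0) * (g 0 - w₀) := by
      have h2 := hke z hzR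
      have h3 := hke 0 h0R
      simp only [Pi.sub_apply] at h2 h3
      rw [← h2, ← h3, ← Complex.exp_add, sub_add_cancel]
    rw [h1, norm_mul, Complex.norm_exp]
    gcongr
    exact (Complex.re_le_norm _).trans hosc
  have h1 : ‖g z‖ ≤ ‖g z - w₀‖ + ‖w₀‖ := by simpa using norm_add_le (g z - w₀) w₀
  have h2 : Real.exp 288 * ‖g 0 - w₀‖ ≤ Real.exp 288 * (‖g 0‖ + ‖w₀‖) := by
    gcongr
    exact norm_sub_le _ _
  linarith

/-! ### The maximum modulus -/

theorem norm_le_maxModulus_norm {f : ℂ → ℂ} (hf : Continuous f) (z : ℂ) :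
    ‖f z‖ ≤ maxModulus f ‖z‖ :=
  le_csSup ((isCompact_sphere (0 : ℂ) ‖z‖).image hf.norm).bddAbove ⟨z, by simp, rfl⟩

theorem exists_norm_eq_maxModulus {f : ℂ → ℂ} (hf : Continuous f) {r : ℝ} (hr : 0 ≤ r) :
    ∃ z : ℂ, ‖z‖ = r ∧ ‖f z‖ = maxModulus f r := by
  have hne : (sphere (0 : ℂ) r).Nonempty := NormedSpace.sphere_nonempty.2 hr
  obtain ⟨z, hz, hz'⟩ :=
    ((isCompact_sphere (0 : ℂ) r).image hf.norm).sSup_mem (hne.image _)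
  exact ⟨z, by simpa using hz, hz'⟩

theorem norm_le_maxModulus {f : ℂ → ℂ} (hf : Differentiable ℂ f) {z : ℂ} {r : ℝ} (hz : ‖z‖ ≤ r) :
    ‖f z‖ ≤ maxModulus f r := by
  rcases ((norm_nonneg z).trans hz).eq_or_lt with h | h
  · have h1 : ‖z‖ = r := le_antisymm hz (h ▸ norm_nonneg z)
    exact h1 ▸ norm_le_maxModulus_norm hf.continuous z
  · refine Complex.norm_le_of_forall_mem_frontier_norm_le (isBounded_ball (x := (0 : ℂ)) (r := r))
      hf.diffContOnCl (fun w hw => ?_) (by rwa [closure_ball _ h.ne', mem_closedBall_zero_iff])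
    rw [frontier_ball _ h.ne', mem_sphere_zero_iff_norm] at hw
    exact hw ▸ norm_le_maxModulus_norm hf.continuous w

theorem maxModulus_nonneg {f : ℂ → ℂ} (r : ℝ) : 0 ≤ maxModulus f r :=
  Real.sSup_nonneg (by rintro _ ⟨z, -, rfl⟩; exact norm_nonneg _)

theorem maxModulus_mono {f : ℂ → ℂ} (hf : Differentiable ℂ f) {r s : ℝ} (hr : 0 ≤ r)
    (hrs : r ≤ s) : maxModulus f r ≤ maxModulus f s := by
  obtain ⟨z, hz, hz'⟩ := exists_norm_eq_maxModulus hf.continuous hr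
  exact hz' ▸ norm_le_maxModulus hf (hz.trans_le hrs)

theorem continuousOn_maxModulus {f : ℂ → ℂ} (hf : Continuous f) :
    ContinuousOn (maxModulus f) (Set.Ici 0) := by
  have h : Continuous fun r : ℝ => sSup ((fun u : ℂ => ‖f (r * u)‖) '' sphere (0 : ℂ) 1) :=
    (isCompact_sphere (0 : ℂ) 1).continuous_sSup (by
      show Continuous fun p : ℝ × ℂ => ‖f (p.1 * p.2)‖
      fun_prop)
  refine h.continuousOn.congr fun r hr => ?_
  have hr : 0 ≤ r := hr
  rw [maxModulus]
  congr 1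
  ext y
  constructor
  · rintro ⟨z, hz, rfl⟩
    rw [mem_sphere_zero_iff_norm] at hz
    rcases hr.eq_or_lt with h0 | h0
    · subst h0
      exact ⟨1, by simp, by simp [norm_eq_zero.1 hz]⟩
    · have : (r : ℂ) ≠ 0 := by exact_mod_cast h0.ne'
      exact ⟨z / r, by simp [hz, abs_of_pos h0, h0.ne'], by simp [mul_div_cancel₀ _ this]⟩
  · rintro ⟨u, hu, rfl⟩
    rw [mem_sphere_zero_iff_norm] at hu
    exact ⟨r * u, by simp [hu, abs_of_nonneg hr], rfl⟩

/-- A consequence of **Hadamard's three circles theorem**. -/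
theorem maxModulus_pow_le {g : ℂ → ℂ} (hg : Differentiable ℂ g) {r : ℝ} (hr : 1 < r) (n : ℕ) :
    maxModulus g r ^ (n + 1) ≤ maxModulus g 1 ^ n * maxModulus g (r ^ (n + 1)) := by
  obtain ⟨z, hz, hz'⟩ := exists_norm_eq_maxModulus hg.continuous (zero_le_one.trans hr.le)
  have hz0 : z ≠ 0 := norm_pos_iff.1 (by linarith)
  have hlog : 0 < Real.log r := Real.log_pos hr
  have hn : (0 : ℝ) < n + 1 := by positivity
  have hu : 0 < (n + 1) * Real.log r := by positivity
  have hre : (Complex.log z).re = Real.log r := by rw [Complex.log_re, hz]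
  have hexpu : Real.exp ((n + 1) * Real.log r) = r ^ (n + 1) := by
    rw [mul_comm, Real.exp_mul, Real.exp_log (by linarith)]
    exact_mod_cast Real.rpow_natCast r (n + 1)
  have hd : Differentiable ℂ fun w => g (Complex.exp w) := hg.comp Complex.differentiable_exp
  have key := Complex.HadamardThreeLines.norm_le_interp_of_mem_verticalClosedStrip'
    (f := fun w => g (Complex.exp w)) (z := Complex.log z) (a := maxModulus g 1)
    (b := maxModulus g (r ^ (n + 1))) hu ?_ hd.diffContOnCl ?_ ?_ ?_
  · rw [Complex.exp_log hz0, hz', hre, sub_zero, sub_zero,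
      show Real.log r / ((n + 1) * Real.log r) = 1 / (n + 1) by field_simp] at key
    have h1 := pow_le_pow_left₀ (maxModulus_nonneg r) key (n + 1)
    refine h1.trans_eq ?_
    rw [mul_pow, ← Real.rpow_mul_natCast (maxModulus_nonneg _),
      ← Real.rpow_mul_natCast (maxModulus_nonneg _)]
    push_cast
    rw [show (1 - 1 / ((n : ℝ) + 1)) * (n + 1) = n by field_simp; ring,
      one_div_mul_cancel hn.ne', Real.rpow_natCast, Real.rpow_one]
  · show (Complex.log z).re ∈ Set.Icc 0 _
    rw [hre]
    exact ⟨hlog.le, by nlinarith [(Nat.cast_nonneg n : (0 : ℝ) ≤ n)]⟩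
  · refine ⟨maxModulus g (r ^ (n + 1)), ?_⟩
    rintro _ ⟨w, hw, rfl⟩
    refine norm_le_maxModulus hg ?_
    rw [Complex.norm_exp, ← hexpu]
    exact Real.exp_le_exp.2 hw.2
  · intro w hw
    refine norm_le_maxModulus hg ?_
    rw [Complex.norm_exp, show w.re = 0 from hw, Real.exp_zero]
  · intro w hw
    refine norm_le_maxModulus hg ?_
    rw [Complex.norm_exp, show w.re = _ from hw, hexpu]

/-- The Schwarz lemma on the disc of radius r. Linear growth is all that can be asked, since the
inner map may be the identity. -/
theorem exists_mul_le_maxModulus {g : ℂ → ℂ} (hg : Differentiable ℂ g)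
    (hne : ∃ z w, g z ≠ g w) : ∃ c > 0, ∀ᶠ r in atTop, c * r ≤ maxModulus g r := by
  obtain ⟨z, hz⟩ : ∃ z, g z ≠ g 0 := by
    by_contra! h
    obtain ⟨z, w, hzw⟩ := hne
    exact hzw ((h z).trans (h w).symm)
  have hz0 : 0 < ‖z‖ := norm_pos_iff.2 (by rintro rfl; exact hz rfl)
  have hd : 0 < ‖g z - g 0‖ := norm_pos_iff.2 (sub_ne_zero.2 hz)
  have hc : 0 < ‖g z - g 0‖ / ‖z‖ := by positivity
  refine ⟨‖g z - g 0‖ / ‖z‖ / 2, by positivity, ?_⟩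
  filter_upwards [eventually_gt_atTop ‖z‖,
    eventually_ge_atTop (‖g 0‖ / (‖g z - g 0‖ / ‖z‖ / 2))] with r hr hr'
  have hr0 : 0 < r := hz0.trans hr
  have hs := Complex.dist_le_div_mul_dist_of_mapsTo_ball (f := g) (c := 0) (z := z) (R₁ := r)
    (R₂ := maxModulus g r + ‖g 0‖) hg.differentiableOn (fun w hw => ?_) (by simpa using hr)
  · rw [dist_eq_norm, dist_zero_right, div_mul_eq_mul_div, le_div_iff₀ hr0] at hs
    have h1 : ‖g z - g 0‖ / ‖z‖ * r ≤ maxModulus g r + ‖g 0‖ := by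
      rw [div_mul_eq_mul_div, div_le_iff₀ hz0]
      exact hs
    rw [div_le_iff₀ (by positivity)] at hr'
    linarith
  · rw [mem_closedBall, dist_eq_norm]
    refine (norm_sub_le _ _).trans (add_le_add_left (norm_le_maxModulus hg ?_) _)
    exact (mem_ball_zero_iff.1 hw).le

theorem tendsto_maxModulus_atTop {g : ℂ → ℂ} (hg : Differentiable ℂ g)
    (hne : ∃ z w, g z ≠ g w) : Tendsto (maxModulus g) atTop atTop := by
  obtain ⟨c, hc, h⟩ := exists_mul_le_maxModulus hg hne
  exact tendsto_atTop_mono' _ h (tendsto_id.const_mul_atTop hc)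

/-- The range of `g` contains an open set, so the identity theorem applies to `f`. -/
theorem exists_ne_comp {f g : ℂ → ℂ} (hf : Differentiable ℂ f) (hg : Differentiable ℂ g)
    (hfne : ∃ z w, f z ≠ f w) (hgne : ∃ z w, g z ≠ g w) : ∃ z w, (f ∘ g) z ≠ (f ∘ g) w := by
  by_contra! hconst
  obtain ⟨a, b, hab⟩ := hgne
  have hopen : IsOpenMap g := by
    refine (AnalyticOnNhd.is_constant_or_isOpenMap
      (hg.differentiableOn.analyticOnNhd isOpen_univ)).resolve_left ?_
    rintro ⟨w, hw⟩
    exact hab ((hw a).trans (hw b).symm)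
  have heq : f = fun _ => f (g 0) := by
    refine AnalyticOnNhd.eq_of_eventuallyEq (z₀ := g 0)
      (hf.differentiableOn.analyticOnNhd isOpen_univ) analyticOnNhd_const ?_
    filter_upwards [hopen.range_mem_nhds (0 : ℂ)] with w hw
    obtain ⟨x, rfl⟩ := hw
    exact hconst x 0
  obtain ⟨z, w, hzw⟩ := hfne
  rw [heq] at hzw
  exact hzw rfl

theorem IsTranscendentalEntire.exists_ne {f : ℂ → ℂ} (hf : IsTranscendentalEntire f) :
    ∃ z w, f z ≠ f w := by
  by_contra! h
  exact hf.2 ⟨Polynomial.C (f 0), fun z => by simpa using h z 0⟩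

theorem differentiable_composition {fs : List (ℂ → ℂ)}
    (hfs : ∀ g ∈ fs, IsTranscendentalEntire g) : Differentiable ℂ (composition fs) := by
  induction fs with
  | nil => exact differentiable_id
  | cons g gs ih =>
    exact (hfs g (by simp)).1.comp (ih fun h hh => hfs h (by simp [hh]))

theorem exists_ne_composition {fs : List (ℂ → ℂ)}
    (hfs : ∀ g ∈ fs, IsTranscendentalEntire g) :
    ∃ z w, composition fs z ≠ composition fs w := by
  induction fs with
  | nil => exact ⟨0, 1, by simp [composition]⟩
  | cons g gs ih =>
    have h := fun h hh => hfs h (List.mem_cons_of_mem g hh)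
    exact exists_ne_comp (f := g) (hfs g (by simp)).1 (differentiable_composition h)
      (hfs g (by simp)).exists_ne (ih h)

/-! ### Growth of the composition -/

theorem exists_log_maxModulus_le {f : ℂ → ℂ} (hord : order f < ⊤) :
    ∃ b > (0 : ℝ), ∀ᶠ r in atTop, Real.log (maxModulus f r) ≤ r ^ b := by
  obtain ⟨b, hb, -⟩ := EReal.lt_iff_exists_real_btwn.1 hord
  refine ⟨max b 1, by positivity, ?_⟩
  filter_upwards [eventually_lt_of_limsup_lt hb, eventually_gt_atTop 1] with r hr hr1
  have hr0 : 0 < r := by linarith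
  have hlog : 0 < Real.log r := Real.log_pos hr1
  rw [EReal.coe_lt_coe_iff, div_lt_iff₀ hlog] at hr
  rcases le_or_gt (Real.log (maxModulus f r)) 0 with h | h
  · exact h.trans (Real.rpow_pos_of_pos hr0 _).le
  · rw [← Real.log_le_log_iff h (Real.rpow_pos_of_pos hr0 _), Real.log_rpow hr0]
    refine hr.le.trans ?_
    gcongr
    exact le_max_left _ _

theorem exists_le_log_maxModulus {f : ℂ → ℂ} (hf : Differentiable ℂ f) (hne : ∃ z w, f z ≠ f w)
    (hlow : 0 < lowerOrder f) :
    ∃ a > (0 : ℝ), ∀ᶠ r in atTop, r ^ a ≤ Real.log (maxModulus f r) := by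
  obtain ⟨a, ha, ha'⟩ := EReal.lt_iff_exists_real_btwn.1 hlow
  refine ⟨a, by exact_mod_cast ha, ?_⟩
  filter_upwards [eventually_lt_of_lt_liminf ha', eventually_gt_atTop 1,
    (tendsto_maxModulus_atTop hf hne).eventually_gt_atTop 1] with r hr hr1 hM
  have hr0 : 0 < r := by linarith
  rw [EReal.coe_lt_coe_iff, lt_div_iff₀ (Real.log_pos hr1)] at hr
  rw [← Real.log_le_log_iff (Real.rpow_pos_of_pos hr0 _) (Real.log_pos hM), Real.log_rpow hr0]
  exact hr.le

theorem maxModulus_comp_le {f g : ℂ → ℂ} (hf : Differentiable ℂ f) (hg : Differentiable ℂ g)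
    {r : ℝ} (hr : 0 ≤ r) : maxModulus (f ∘ g) r ≤ maxModulus f (maxModulus g r) := by
  obtain ⟨z, hz, hz'⟩ := exists_norm_eq_maxModulus (hf.comp hg).continuous hr
  rw [← hz']
  exact norm_le_maxModulus hf (norm_le_maxModulus hg hz.le)

/-- A weak form of **Pólya's theorem** on the growth of composite functions. -/
theorem exists_maxModulus_le_maxModulus_comp {f g : ℂ → ℂ} (hf : Differentiable ℂ f)
    (hg : Differentiable ℂ g) (hne : ∃ z w, g z ≠ g w) :
    ∃ C > 0, ∀ᶠ r in atTop,
      maxModulus f (maxModulus g (r / 2) / C) ≤ maxModulus (f ∘ g) r := by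
  obtain ⟨E, hE⟩ : ∃ E, E = Real.exp 288 := ⟨_, rfl⟩
  have hE1 : 1 ≤ E := hE ▸ Real.one_le_exp (by norm_num)
  have hE0 : 0 < E := by linarith
  have htend : Tendsto (fun r : ℝ => maxModulus g (r / 2)) atTop atTop :=
    (tendsto_maxModulus_atTop hg hne).comp (tendsto_id.atTop_div_const two_pos)
  -- With E s = m/4, s ≤ m/4 and E ‖g 0‖ < m/2, the bound m ≤ s + E (‖g 0‖ + s) is contradictory.
  refine ⟨4 * E, by positivity, ?_⟩
  filter_upwards [eventually_gt_atTop 0, htend.eventually_gt_atTop (2 * (E * ‖g 0‖))] with r hr hM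
  obtain ⟨m, hm⟩ : ∃ m, m = maxModulus g (r / 2) := ⟨_, rfl⟩
  obtain ⟨s, hs⟩ : ∃ s, s = m / (4 * E) := ⟨_, rfl⟩
  rw [← hm] at hM ⊢
  rw [← hs]
  have hm0 : 0 < m := lt_of_le_of_lt (by positivity) hM
  have hs0 : 0 < s := by rw [hs]; positivity
  obtain ⟨w₀, hw, hw'⟩ := exists_norm_eq_maxModulus hf.continuous hs0.le
  obtain ⟨z, hz, hz'⟩ := exists_norm_eq_maxModulus hg.continuous (half_pos hr).le
  by_contra! hlt
  rw [← hw'] at hlt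
  have key := norm_le_of_norm_comp_le hr hf hg.differentiableOn
    (fun x hx => norm_le_maxModulus (hf.comp hg) (mem_ball_zero_iff.1 hx).le) hlt hz.le
  rw [hz', hw, ← hm, ← hE] at key
  have hEs : E * s = m / 4 := by rw [hs]; field_simp
  have hsE : s ≤ E * s := le_mul_of_one_le_left hs0.le hE1
  rw [mul_add] at key
  linarith

/-- Lower bound for the growth of `f ∘ g` when `f` has positive lower order. -/
theorem exists_rpow_le_log_maxModulus_comp {f g : ℂ → ℂ} (hf : Differentiable ℂ f)
    (hg : Differentiable ℂ g) (hfne : ∃ z w, f z ≠ f w) (hgne : ∃ z w, g z ≠ g w)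
    (hlow : 0 < lowerOrder f) :
    ∃ a > (0 : ℝ), ∃ C > 0, ∀ᶠ r in atTop,
      (maxModulus g (r / 2) / C) ^ a ≤ Real.log (maxModulus (f ∘ g) r) := by
  obtain ⟨a, ha, hfa⟩ := exists_le_log_maxModulus hf hfne hlow
  obtain ⟨C, hC, hpolya⟩ := exists_maxModulus_le_maxModulus_comp hf hg hgne
  have htend : Tendsto (fun r : ℝ => maxModulus g (r / 2) / C) atTop atTop :=
    ((tendsto_maxModulus_atTop hg hgne).comp
      (tendsto_id.atTop_div_const two_pos)).atTop_div_const hC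
  refine ⟨a, ha, C, hC, ?_⟩
  filter_upwards [htend.eventually hfa, hpolya,
    htend.eventually ((tendsto_maxModulus_atTop hf hfne).eventually_gt_atTop 0)] with r h1 h2 h3
  exact h1.trans (Real.log_le_log h3 h2)

/-- Regularity of growth of `f ∘ g`: the function `μ_{2,ε}` dominates `M(·, f ∘ g)` after
conjugation by a power. -/
theorem exists_maxModulus_pow_le_mu2 {f g : ℂ → ℂ} (hf : Differentiable ℂ f)
    (hg : Differentiable ℂ g) (hfne : ∃ z w, f z ≠ f w) (hgne : ∃ z w, g z ≠ g w)
    (hord : order f < ⊤) (hlow : 0 < lowerOrder f) {ε : ℝ} (hε : 0 < ε) :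
    ∃ k : ℕ, k ≠ 0 ∧ ∀ᶠ r in atTop, maxModulus (f ∘ g) r ^ k ≤ mu2 (f ∘ g) ε (r ^ k) := by
  obtain ⟨b, hb, hfb⟩ := exists_log_maxModulus_le hord
  obtain ⟨a, ha, C, hC, hlower⟩ := exists_rpow_le_log_maxModulus_comp hf hg hfne hgne hlow
  -- Ensures b + 1 ≤ n a ε; the extra 1 pays for the factor n + 2 ≤ m.
  obtain ⟨n, hn⟩ := exists_nat_ge ((b + 1) / (a * ε))
  rw [div_le_iff₀ (by positivity)] at hn
  have hgt := tendsto_maxModulus_atTop hg hgne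
  have hpow : Tendsto (fun r : ℝ => r ^ (n + 2)) atTop atTop := tendsto_pow_atTop (by simp)
  -- One power of r absorbs the halving in the lower bound. Of the m^(n+1) from three circles, one
  -- factor m absorbs `maxModulus g 1 ^ n` and C, leaving m^n.
  refine ⟨n + 2, by simp, ?_⟩
  have hA : 0 ≤ maxModulus g 1 ^ n := pow_nonneg (maxModulus_nonneg _) _
  filter_upwards [hgt.eventually hfb, hpow.eventually hlower, eventually_ge_atTop 2,
    hgt.eventually_ge_atTop ((maxModulus g 1 ^ n + 1) * C), hgt.eventually_ge_atTop (n + 2),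
    (tendsto_maxModulus_atTop (hf.comp hg)
      (exists_ne_comp hf hg hfne hgne)).eventually_ge_atTop 1] with r h1 h2 hr hmA hmn hF
  have hr0 : 0 ≤ r := by linarith
  obtain ⟨m, hm⟩ : ∃ m, m = maxModulus g r := ⟨_, rfl⟩
  rw [← hm] at h1 hmA hmn
  have hm1 : 1 ≤ m := by linarith [(Nat.cast_nonneg n : (0 : ℝ) ≤ n)]
  have hm0 : 0 < m := by linarith
  have hup : Real.log (maxModulus (f ∘ g) r) ≤ m ^ b :=
    (Real.log_le_log (by linarith) (hm ▸ maxModulus_comp_le hf hg hr0)).trans h1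
  have hbase : m ^ n ≤ maxModulus g (r ^ (n + 2) / 2) / C := by
    rw [le_div_iff₀ hC]
    have h3 : maxModulus g (r ^ (n + 1)) ≤ maxModulus g (r ^ (n + 2) / 2) := by
      refine maxModulus_mono hg (by positivity) ?_
      rw [pow_succ r (n + 1), le_div_iff₀ two_pos]
      gcongr
    have h4 := maxModulus_pow_le hg (show 1 < r by linarith) n
    rw [← hm] at h4
    have h5 : (maxModulus g 1 ^ n + 1) * (m ^ n * C) ≤
        (maxModulus g 1 ^ n + 1) * maxModulus g (r ^ (n + 2) / 2) := by
      calc (maxModulus g 1 ^ n + 1) * (m ^ n * C)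
          = m ^ n * ((maxModulus g 1 ^ n + 1) * C) := by ring
        _ ≤ m ^ n * m := by gcongr
        _ = m ^ (n + 1) := (pow_succ _ _).symm
        _ ≤ maxModulus g 1 ^ n * maxModulus g (r ^ (n + 1)) := h4
        _ ≤ (maxModulus g 1 ^ n + 1) * maxModulus g (r ^ (n + 2) / 2) := by
            have := maxModulus_nonneg (f := g) (r ^ (n + 1))
            gcongr
            linarith
    exact le_of_mul_le_mul_left h5 (by linarith)
  have hlow' : (m ^ n) ^ a ≤ Real.log (maxModulus (f ∘ g) (r ^ (n + 2))) :=
    (Real.rpow_le_rpow (by positivity) hbase ha.le).trans h2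
  have hlog0 := Real.log_nonneg hF
  have hfinal : (n + 2) * Real.log (maxModulus (f ∘ g) r) ≤
      Real.log (maxModulus (f ∘ g) (r ^ (n + 2))) ^ ε := by
    calc (n + 2) * Real.log (maxModulus (f ∘ g) r) ≤ m * m ^ b := by gcongr
      _ = m ^ (b + 1) := by rw [Real.rpow_add_one hm0.ne', mul_comm]
      _ ≤ m ^ (n * (a * ε)) := Real.rpow_le_rpow_of_exponent_le hm1 hn
      _ = ((m ^ n) ^ a) ^ ε := by
          rw [Real.rpow_mul hm0.le, Real.rpow_natCast, Real.rpow_mul (by positivity)]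
      _ ≤ _ := Real.rpow_le_rpow (by positivity) hlow' hε.le
  rw [mu2, ← Real.log_le_iff_le_exp (pow_pos (by linarith) _), Real.log_pow]
  exact_mod_cast hfinal

/-- Supplies an admissible R for ε = 1/2: the square root of log M grows at least like a positive
power of r, which beats log r. -/
theorem eventually_lt_mu2_half {f g : ℂ → ℂ} (hf : Differentiable ℂ f)
    (hg : Differentiable ℂ g) (hfne : ∃ z w, f z ≠ f w) (hgne : ∃ z w, g z ≠ g w)
    (hlow : 0 < lowerOrder f) : ∀ᶠ r in atTop, r < mu2 (f ∘ g) (1 / 2) r := by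
  obtain ⟨a, ha, C, hC, hlower⟩ := exists_rpow_le_log_maxModulus_comp hf hg hfne hgne hlow
  obtain ⟨c, hc, hgc⟩ := exists_mul_le_maxModulus hg hgne
  have hd : 0 < c / 2 / C := by positivity
  have hd' : 0 < (c / 2 / C) ^ (a / 2) := Real.rpow_pos_of_pos hd _
  filter_upwards [hlower, (tendsto_id.atTop_div_const two_pos).eventually hgc,
    (isLittleO_log_rpow_atTop (half_pos ha)).bound (half_pos hd'),
    eventually_gt_atTop 0] with r h1 h2 h3 hr
  have hra : 0 < r ^ (a / 2) := Real.rpow_pos_of_pos hr _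
  have h4 : c / 2 / C * r ≤ maxModulus g (r / 2) / C := by
    rw [div_mul_eq_mul_div]
    gcongr
    calc c / 2 * r = c * (r / 2) := by ring
      _ ≤ _ := h2
  have h5 : (c / 2 / C * r) ^ a ≤ Real.log (maxModulus (f ∘ g) r) :=
    (Real.rpow_le_rpow (by positivity) h4 ha.le).trans h1
  have h6 : (c / 2 / C) ^ (a / 2) * r ^ (a / 2) ≤
      Real.log (maxModulus (f ∘ g) r) ^ (1 / 2 : ℝ) := by
    rw [← Real.mul_rpow hd.le hr.le, div_eq_mul_one_div a 2, Real.rpow_mul (by positivity)]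
    exact Real.rpow_le_rpow (by positivity) h5 (by norm_num)
  rw [Real.norm_of_nonneg hra.le] at h3
  have h7 : Real.log r < Real.log (maxModulus (f ∘ g) r) ^ (1 / 2 : ℝ) := by
    have := Real.le_norm_self (Real.log r)
    have : 0 < (c / 2 / C) ^ (a / 2) * r ^ (a / 2) := by positivity
    linarith
  rw [mu2, ← Real.log_lt_iff_lt_exp hr]
  exact h7

/-! ### Comparison of iterates -/

/-- A bounded increasing orbit would converge to a fixed point of φ. -/
theorem exists_le_iterate {φ : ℝ → ℝ} {R : ℝ} (hφ : ContinuousOn φ (Set.Ici R))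
    (h : ∀ r, R ≤ r → r < φ r) (T : ℝ) : ∃ n, T ≤ φ^[n] R := by
  by_contra! hT
  have hge : ∀ n, R ≤ φ^[n] R := by
    intro n
    induction n with
    | zero => exact le_rfl
    | succ n ih =>
      rw [Function.iterate_succ_apply']
      exact ih.trans (h _ ih).le
  have hmono : Monotone fun n => φ^[n] R := by
    refine monotone_nat_of_le_succ fun n => ?_
    rw [Function.iterate_succ_apply']
    exact (h _ (hge n)).le
  have hlim := tendsto_atTop_ciSup hmono ⟨T, by rintro _ ⟨n, rfl⟩; exact (hT n).le⟩
  set L := ⨆ n, φ^[n] R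
  have hL : R ≤ L := ge_of_tendsto' hlim hge
  have h1 : Tendsto (fun n => φ (φ^[n] R)) atTop (𝓝 (φ L)) :=
    (hφ L hL).tendsto.comp (tendsto_nhdsWithin_iff.2 ⟨hlim, Eventually.of_forall hge⟩)
  have h2 : Tendsto (fun n => φ (φ^[n] R)) atTop (𝓝 L) := by
    simpa only [Function.iterate_succ_apply'] using (tendsto_add_atTop_iff_nat 1).2 hlim
  exact (h L hL).ne (tendsto_nhds_unique h2 h1)

theorem mu2_le_mu2 {f : ℂ → ℂ} (hf : Differentiable ℂ f) {ε r s : ℝ} (hε : 0 ≤ ε) (hr : 0 ≤ r)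
    (h1 : 1 ≤ maxModulus f r) (hrs : r ≤ s) : mu2 f ε r ≤ mu2 f ε s := by
  refine Real.exp_le_exp.2 (Real.rpow_le_rpow (Real.log_nonneg h1) ?_ hε)
  exact Real.log_le_log (by linarith) (maxModulus_mono hf hr hrs)

theorem continuousOn_mu2 {f : ℂ → ℂ} (hf : Continuous f) {ε R : ℝ} (hε : 0 ≤ ε) (hR : 0 ≤ R)
    (h1 : ∀ r, R ≤ r → 1 ≤ maxModulus f r) : ContinuousOn (mu2 f ε) (Set.Ici R) := by
  have hM : ContinuousOn (maxModulus f) (Set.Ici R) :=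
    (continuousOn_maxModulus hf).mono (Set.Ici_subset_Ici.2 hR)
  exact ((hM.log fun r hr => (zero_lt_one.trans_le (h1 r hr)).ne').rpow_const
    fun _ _ => Or.inr hε).rexp

theorem mu2_le_maxModulus {f : ℂ → ℂ} {ε r : ℝ} (hε : ε ≤ 1)
    (h : Real.exp 1 ≤ maxModulus f r) : mu2 f ε r ≤ maxModulus f r := by
  have h0 : 0 < maxModulus f r := (Real.exp_pos 1).trans_le h
  rw [mu2, ← Real.le_log_iff_exp_le h0]
  exact Real.rpow_le_self_of_one_le ((Real.le_log_iff_exp_le h0).2 h) hε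

theorem fastEscapingSet_subset {f : ℂ → ℂ} (hf : Differentiable ℂ f)
    (hM : Tendsto (maxModulus f) atTop atTop) {ε : ℝ} (hε : 0 < ε) (hε1 : ε < 1)
    (hmu : ∀ᶠ r in atTop, r < mu2 f ε r) : fastEscapingSet f ⊆ quiteFastEscapingSet2 f := by
  rintro z ⟨R₀, hR₀, hadm, l, hl⟩
  obtain ⟨R, hR⟩ := eventually_atTop.1
    (hmu.and ((hM.eventually_ge_atTop (Real.exp 1)).and (eventually_gt_atTop 0)))
  have hRpos : 0 < R := (hR R le_rfl).2.2
  obtain ⟨m, hm⟩ := exists_le_iterate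
    ((continuousOn_maxModulus hf.continuous).mono (Set.Ici_subset_Ici.2 hR₀.le)) hadm R
  have hcmp : ∀ n, R ≤ (mu2 f ε)^[n] R ∧
      (mu2 f ε)^[n] R ≤ (maxModulus f)^[n] ((maxModulus f)^[m] R₀) := by
    intro n
    induction n with
    | zero => exact ⟨le_rfl, hm⟩
    | succ n ih =>
      rw [Function.iterate_succ_apply', Function.iterate_succ_apply']
      refine ⟨ih.1.trans (hR _ ih.1).1.le, ?_⟩
      exact (mu2_le_maxModulus hε1.le (hR _ ih.1).2.1).trans
        (maxModulus_mono hf (hRpos.le.trans ih.1) ih.2)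
  refine ⟨ε, hε, hε1, R, hRpos, fun r hr => ⟨?_, (hR r hr).1⟩, m + l, fun n => ?_⟩
  · exact (Real.one_le_exp zero_le_one).trans (hR r hr).2.1
  · have h := hl (n + m)
    rw [Function.iterate_add_apply (maxModulus f)] at h
    rw [← add_assoc]
    exact (hcmp n).2.trans h

/-- The inequality `hreg` propagates by induction to kth powers of the M-orbit, after the μ-orbit
has been run far enough to start above r₀^k; the delay is absorbed in ℓ. -/
theorem quiteFastEscapingSet2_subset {f : ℂ → ℂ} (hf : Differentiable ℂ f)
    (hM : Tendsto (maxModulus f) atTop atTop)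
    (hreg : ∀ ε : ℝ, 0 < ε → ε < 1 →
      ∃ k : ℕ, k ≠ 0 ∧ ∀ᶠ r in atTop, maxModulus f r ^ k ≤ mu2 f ε (r ^ k)) :
    quiteFastEscapingSet2 f ⊆ fastEscapingSet f := by
  rintro z ⟨ε, hε, hε1, R, hR, hadm, l, hl⟩
  obtain ⟨k, hk, hreg⟩ := hreg ε hε hε1
  obtain ⟨r₀, hr₀⟩ := eventually_atTop.1 (hreg.and ((hM.eventually_ge_atTop (Real.exp 1)).and
    ((eventually_ge_atTop R).and (eventually_ge_atTop 1))))
  have hr₀1 : 1 ≤ r₀ := (hr₀ r₀ le_rfl).2.2.2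
  have hlt : ∀ r, r₀ ≤ r → r < maxModulus f r := fun r hr =>
    (hadm r (hr₀ r hr).2.2.1).2.trans_le (mu2_le_maxModulus hε1.le (hr₀ r hr).2.1)
  obtain ⟨m, hm⟩ := exists_le_iterate
    (continuousOn_mu2 hf.continuous hε.le hR.le fun r hr => (hadm r hr).1)
    (fun r hr => (hadm r hr).2) (r₀ ^ k)
  have hcmp : ∀ n, r₀ ≤ (maxModulus f)^[n] r₀ ∧
      (maxModulus f)^[n] r₀ ^ k ≤ (mu2 f ε)^[n] ((mu2 f ε)^[m] R) := by
    intro n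
    induction n with
    | zero => exact ⟨le_rfl, hm⟩
    | succ n ih =>
      rw [Function.iterate_succ_apply', Function.iterate_succ_apply']
      obtain ⟨hreg', -, hR', h1'⟩ := hr₀ _ ih.1
      have hRk : R ≤ (maxModulus f)^[n] r₀ ^ k := hR'.trans (le_self_pow₀ h1' hk)
      exact ⟨ih.1.trans (hlt _ ih.1).le, hreg'.trans
        (mu2_le_mu2 hf hε.le (hR.le.trans hRk) (hadm _ hRk).1 ih.2)⟩
  refine ⟨r₀, by linarith, hlt, m + l, fun n => ?_⟩
  have h := hl (n + m)
  rw [Function.iterate_add_apply (mu2 f ε)] at h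
  rw [← add_assoc]
  exact (le_self_pow₀ (hr₀1.trans (hcmp n).1) hk).trans ((hcmp n).2.trans h)

end FastEscape

theorem theorem1p1 (f₁ : ℂ → ℂ) (fs : List (ℂ → ℂ))
    (hf₁ : FastEscape.IsTranscendentalEntire f₁)
    (hfs : ∀ g ∈ fs, FastEscape.IsTranscendentalEntire g)
    (hord : FastEscape.order f₁ < ⊤)
    (hlow : 0 < FastEscape.lowerOrder f₁) :
    FastEscape.quiteFastEscapingSet2 (FastEscape.composition (f₁ :: fs)) =
      FastEscape.fastEscapingSet (FastEscape.composition (f₁ :: fs)) := by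
  have hg := FastEscape.differentiable_composition hfs
  have hgne := FastEscape.exists_ne_composition hfs
  have hf := hf₁.1.comp hg
  have hM := FastEscape.tendsto_maxModulus_atTop hf
    (FastEscape.exists_ne_comp hf₁.1 hg hf₁.exists_ne hgne)
  refine Set.Subset.antisymm (FastEscape.quiteFastEscapingSet2_subset hf hM fun ε hε _ => ?_)
    (FastEscape.fastEscapingSet_subset hf hM (ε := 1 / 2) (by norm_num) (by norm_num) ?_)
  · exact FastEscape.exists_maxModulus_pow_le_mu2 (f := f₁) hf₁.1 hg hf₁.exists_ne hgne hord hlow hε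
  · exact FastEscape.eventually_lt_mu2_half (f := f₁) hf₁.1 hg hf₁.exists_ne hgne hlow
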